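/- Let $k\ge 1$ and let $A_k$ be the Aztec diamond of size $k$, rotated by $45^\circ$: its vertices are the points $(x,y)\in\{0,\dots,2k\}^2$ with $x+y$ odd, white if $x$ is even and black if $x$ is odd; its edges join the points $(x,y)$ and $(x\pm1,y\pm1)$ (all signs allowed); its faces are centred at the points $(i,j)\in\{0,\dots,2k\}^2$ with $i+j$ even, a face being inner if $0<i,j<2k$ and open otherwise. An edge separates the two faces whose centres are at distance $1$ from both of its endpoints. For a directed edge $\vec e$, let $f(\vec e)$ be the face on its right. The degree $d(f)$ of a face is the number of edges adjacent to it. A Kasteleyn orientation is a skew-symmetric function $\varphi$ from directed edges to $\{-1,1\}$ such that, for every inner face $f$ of degree $2m$, the product of $\varphi_{(w,b)}$ over the edges $wb$ (with $w$ white and $b$ black) of the boundary of $f$ is $(-1)^{m+1}$. An oriented dimer configuration is a set $\vec{\mathsf M}$ of directed edges such that every vertex is an endpoint (origin or tip) of exactly one element of $\vec{\mathsf M}$. For face weights $a=(a_{i,j})$ set \[ Z(A_k,a,\varphi)=\sum_{\vec{\mathsf M}}\ \prod_{\vec e\in\vec{\mathsf M}}\varphi_{\vec e}\,a_{f(\vec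 e)},\qquad Y(A_k,a)=C(A_k,a)\,\frac{Z(A_k,a^{-1},\varphi)}{Z(A_k,a,\varphi)}, \] \[ C(A_k,a)=\mathrm i^{|V|}\prod_{f\text{ inner}}a_f^{\frac{d(f)}2-1}\prod_{f\text{ open}}a_f^{\lceil d(f)/2\rceil}, \] where $V$ is the vertex set of $A_k$ and $a^{-1}=(a_f^{-1})_f$. Here $Y$ takes values in $\hat{\mathbb C}=\mathbb C\cup\{\infty\}$ and is undefined when the quotient is $0/0$. For weights in $\hat{\mathbb C}$, where $0$ and $\infty$ are allowed, write $a_f=[x_f:y_f]$ in homogeneous coordinates ($z=[z:1]$, $\infty=[1:0]$); then $Y$ is the quotient of the polynomials in $(x,y)$ obtained from $C(A_k,a)Z(A_k,a^{-1},\varphi)$ and $Z(A_k,a,\varphi)$ by substituting $a_f=x_f/y_f$ and multiplying both by $\prod_f y_f^{n_f}$, where $n_f$ is the exponent of $a_f$ in $C(A_k,a)$. Suppose that the odd columns of weights are constant: there are $(d_i)_{0\le i\le k-1}$ with $a_{2i+1,2j+1}=d_i$ for all $0\le i,j\le k-1$. Let $\tilde a$ be the weights obtained by a vertical cyclic shift: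 $\tilde a_{2i,2j}=a_{2i,2j'}$ for $0\le i,j\le k$, with $j'\in\{0,\dots,k\}$ and $j'\equiv j+1 \pmod{k+1}$, and $\tilde a_{2i+1,2j+1}=d_i$ for $0\le i,j\le k-1$. Then, for complex weights $a$ and for every Kasteleyn orientation $\varphi$, \[ Z(A_k,a,\varphi)=(-1)^k\,Z(A_k,\tilde a,\varphi). \] Furthermore, for weights $a$ in $\hat{\mathbb C}$, the ratio functions are equal: \[ Y(A_k,a)=Y(A_k,\tilde a), \] that is, one side is defined if and only if the other is, and they then agree, whatever Kasteleyn orientations are used to compute the two sides. -/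

import Mathlib

noncomputable section

/-- The combinatorial data of a finite planar bipartite graph with open faces: `W`, `B` are the
white and black vertices, `F` the (inner and open) faces. Every edge `wb` separates two faces;
`rightFace w b` is the face on the right of the directed edge `(w, b)` and `leftFace w b` the one
on its left, that is, on the right of `(b, w)`. The values of these two functions matter only at
edges. Faces that are not inner are open. -/
structure FaceGraph (W B F : Type) where
  edges : Finset (W × B)
  rightFace : W → B → F
  leftFace : W → B → F
  innerFaces : Finset F

/-- A directed edge: `(w, b, true)` is the edge `wb` directed from `w` to `b`, and
`(w, b, false)` is the same edge directed from `b` to `w`. -/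
abbrev DirEdge (W B : Type) : Type := W × B × Bool

namespace FaceGraph

open scoped Classical

variable {W B F : Type} [Fintype W] [Fintype B] [Fintype F] (G : FaceGraph W B F)

/-- The face on the right of a directed edge. -/
def faceOf (e : DirEdge W B) : F :=
  if e.2.2 = true then G.rightFace e.1 e.2.1 else G.leftFace e.1 e.2.1

/-- The set of edges on the boundary of the face `f`. -/
def boundary (f : F) : Finset (W × B) :=
  G.edges.filter fun e => G.rightFace e.1 e.2 = f ∨ G.leftFace e.1 e.2 = f

/-- The degree of a face: the number of edges adjacent to it. -/
def faceDegree (f : F) : ℕ := (G.boundary f).card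

/-- A Kasteleyn orientation: a skew-symmetric function from directed edges to `{-1, 1}` such that
for every inner face of degree `2m` the product of the `φ (w, b)`, over the edges `wb` of its
boundary, is `(-1) ^ (m + 1)`. -/
structure IsKasteleyn (φ : DirEdge W B → ℤˣ) : Prop where
  skew : ∀ w b, (w, b) ∈ G.edges → φ (w, b, false) = - φ (w, b, true)
  face : ∀ f ∈ G.innerFaces,
    ∏ e ∈ G.boundary f, φ (e.1, e.2, true) = (-1) ^ (G.faceDegree f / 2 + 1)

/-- An oriented dimer configuration: a set of directed edges of the graph such that every vertex
is an endpoint (origin or tip) of exactly one of them. -/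
def IsOrientedDimer (M : Finset (DirEdge W B)) : Prop :=
  (∀ e ∈ M, (e.1, e.2.1) ∈ G.edges) ∧
  (∀ w : W, ∃! e : DirEdge W B, e ∈ M ∧ e.1 = w) ∧
  (∀ b : B, ∃! e : DirEdge W B, e ∈ M ∧ e.2.1 = b)

/-- The partition function `Z(G, a, φ)` of oriented dimers, for face weights `a` in a commutative
ring (complex weights, or formal weights). -/
def partitionFunction {R : Type} [CommRing R] (φ : DirEdge W B → ℤˣ) (a : F → R) : R :=
  ∑ M : Finset (DirEdge W B) with G.IsOrientedDimer M,
    ∏ e ∈ M, (((φ e : ℤ) : R) * a (G.faceOf e))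

/-- The exponent of the weight of the face `f` in the prefactor of the ratio function:
`d(f)/2 - 1` for an inner face and `⌈d(f)/2⌉` for an open face. -/
def faceExponent (f : F) : ℕ :=
  if f ∈ G.innerFaces then G.faceDegree f / 2 - 1 else (G.faceDegree f + 1) / 2

/-- The constant `i ^ |V|`. -/
def vertexSign (_G : FaceGraph W B F) : ℂ := Complex.I ^ (Fintype.card W + Fintype.card B)

/-- The prefactor `C(G, a)`. -/
def prefactor (a : F → ℂ) : ℂ := G.vertexSign * ∏ f, a f ^ G.faceExponent f

end FaceGraph

/-- The quotient `p / q` of two complex numbers in `ℂ ∪ {∞}`: it is `∞` if only `q` vanishes, and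
undefined (`none`) for `0 / 0`. -/
def quotHat (p q : ℂ) : Option (OnePoint ℂ) :=
  open scoped Classical in
  if q = 0 then (if p = 0 then none else some OnePoint.infty) else some ((p / q : ℂ) : OnePoint ℂ)

/-- First homogeneous coordinate: `z ↦ [z : 1]` and `∞ ↦ [1 : 0]`. -/
def homNum (z : OnePoint ℂ) : ℂ := z.elim 1 id

/-- Second homogeneous coordinate: `z ↦ [z : 1]` and `∞ ↦ [1 : 0]`. -/
def homDen (z : OnePoint ℂ) : ℂ := z.elim 0 (fun _ => 1)

/-- The value at `(x, y)` of the multi-homogenization of the polynomial `P`, where the variable `f`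
is given the degree `n f`; for `P` of degree at most `n f` in each variable `f` it is
`∏ f, y f ^ n f` times the value of `P` at `x / y`. -/
def homEval {F : Type} [Fintype F] (n : F → ℕ) (P : MvPolynomial F ℂ) (x y : F → ℂ) : ℂ :=
  ∑ m ∈ P.support, P.coeff m * ∏ f, (x f ^ m f * y f ^ (n f - m f))

/-- Where no `y f` vanishes, `homEval` is the dehomogenized value times a monomial. -/
theorem homEval_eq {F : Type} [Fintype F] (n : F → ℕ) (P : MvPolynomial F ℂ) (x y : F → ℂ)
    (hP : ∀ m ∈ P.support, ∀ f, m f ≤ n f) (hy : ∀ f, y f ≠ 0) :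
    homEval n P x y = (∏ f, y f ^ n f) * MvPolynomial.eval (fun f => x f / y f) P := by
  rw [MvPolynomial.eval_eq', homEval, Finset.mul_sum]
  refine Finset.sum_congr rfl fun m hm => ?_
  rw [mul_left_comm, ← Finset.prod_mul_distrib]
  congr 1
  refine Finset.prod_congr rfl fun f _ => ?_
  rw [div_pow, pow_sub₀ _ (hy f) (hP m hm f)]
  field_simp [hy f]

namespace FaceGraph

variable {W B F : Type} [Fintype W] [Fintype B] [Fintype F] (G : FaceGraph W B F)

/-- The ratio function `Y(G, a) = C(G, a) Z(G, a⁻¹, φ) / Z(G, a, φ)` in `ℂ ∪ {∞}`, for finite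
nonzero face weights; it is `none` when the quotient is `0 / 0`. -/
def ratio (φ : DirEdge W B → ℤˣ) (a : F → ℂ) : Option (OnePoint ℂ) :=
  quotHat (G.prefactor a * G.partitionFunction φ (fun f => (a f)⁻¹)) (G.partitionFunction φ a)

/-- The ratio function for face weights in `ℂ ∪ {∞}`. In homogeneous coordinates
`a f = [x f : y f]`, multiplying the numerator `C(G, a) Z(G, a⁻¹, φ)` and the denominator
`Z(G, a, φ)` by `∏ f, y f ^ n f`, with `n f` the exponent of `a f` in `C(G, a)`, turns them into
the polynomials `i ^ |V| ∏ x ^ n Z(G, y / x, φ)` and `∏ y ^ n Z(G, x / y, φ)` in `x` and `y`;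
the value is undefined where both vanish. -/
def ratioHat (φ : DirEdge W B → ℤˣ) (a : F → OnePoint ℂ) : Option (OnePoint ℂ) :=
  let P : MvPolynomial F ℂ := G.partitionFunction φ MvPolynomial.X
  let x : F → ℂ := fun f => homNum (a f)
  let y : F → ℂ := fun f => homDen (a f)
  quotHat (G.vertexSign * homEval G.faceExponent P y x) (homEval G.faceExponent P x y)

end FaceGraph

/-- White vertices of the (rotated) Aztec diamond of size `k`: `(i, j)` is the point
`(2i, 2j+1)` of the square `[0, 2k] × [0, 2k]`. -/
abbrev AztecWhite (k : ℕ) : Type := Fin (k + 1) × Fin k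

/-- Black vertices: `(i, j)` is the point `(2i+1, 2j)`. -/
abbrev AztecBlack (k : ℕ) : Type := Fin k × Fin (k + 1)

/-- Faces: `inl (i, j)` is the face centred at `(2i, 2j)`, in the even column `2i`, with weight
`c i j = a (2i) (2j)`; `inr (i, j)` is the face centred at `(2i+1, 2j+1)`, in the odd column
`2i+1`, with weight `d i j = a (2i+1) (2j+1)`. -/
abbrev AztecFace (k : ℕ) : Type := (Fin (k + 1) × Fin (k + 1)) ⊕ (Fin k × Fin k)

/-- The edge from the white vertex `(2i, 2j+1)` to a black vertex `(2i ± 1, 2j+1 ± 1)` goes to the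
east or to the west ... -/
def aztecEast {k : ℕ} (w : AztecWhite k) (b : AztecBlack k) : Prop := b.1.val = w.1.val

def aztecWest {k : ℕ} (w : AztecWhite k) (b : AztecBlack k) : Prop := b.1.val + 1 = w.1.val

/-- ... and to the north or to the south. -/
def aztecNorth {k : ℕ} (w : AztecWhite k) (b : AztecBlack k) : Prop := b.2.val = w.2.val + 1

def aztecSouth {k : ℕ} (w : AztecWhite k) (b : AztecBlack k) : Prop := b.2.val = w.2.val

open scoped Classical in
/-- The Aztec diamond `A_k`, rotated by 45 degrees. The edge from `w = (x, y)` to `b = (x', y')`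
separates the face centred at `(x', y)`, which is `inr (b.1, w.2)`, from the face centred at
`(x, y')`, which is `inl (w.1, b.2)`. The former is on the right of `(w, b)` if the edge goes
north-east or south-west, and on its left if it goes north-west or south-east. The inner faces are
those whose centre lies in the interior of the square. -/
def aztec (k : ℕ) : FaceGraph (AztecWhite k) (AztecBlack k) (AztecFace k) where
  edges := Finset.univ.filter fun e =>
    (aztecEast e.1 e.2 ∨ aztecWest e.1 e.2) ∧ (aztecNorth e.1 e.2 ∨ aztecSouth e.1 e.2)
  rightFace w b :=
    if (aztecEast w b ↔ aztecNorth w b) then Sum.inr (b.1, w.2) else Sum.inl (w.1, b.2)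
  leftFace w b :=
    if (aztecEast w b ↔ aztecNorth w b) then Sum.inl (w.1, b.2) else Sum.inr (b.1, w.2)
  innerFaces := Finset.univ.filter fun f =>
    match f with
    | Sum.inl (i, j) => 0 < i.val ∧ i.val < k ∧ 0 < j.val ∧ j.val < k
    | Sum.inr _ => True

/-- The weights are constant along every odd column. -/
def OddColumnsConstant {k : ℕ} {α : Type} (a : AztecFace k → α) : Prop :=
  ∀ i j j', a (Sum.inr (i, j)) = a (Sum.inr (i, j'))

/-- The vertical cyclic shift `ã (i, j) = a (i, j + 2 mod 2(k+1))`. In an even column this is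
`c i j ↦ c i (j + 1 mod (k+1))`, the addition `j + 1` in `Fin (k + 1)` being cyclic. The odd
columns, which are constant where the shift is used, are unchanged. -/
def verticalShift {k : ℕ} {α : Type} (a : AztecFace k → α) : AztecFace k → α
  | Sum.inl (i, j) => a (Sum.inl (i, j + 1))
  | Sum.inr (i, j) => a (Sum.inr (i, j))

end

/-! By skew-symmetry the two directions of an edge combine into the weight `φ (w, b) * (a_right -
a_left)`, so the partition function is a permanent (`partitionFunction_eq_sum_equiv`). Kasteleyn's
theorem turns it into ± the determinant of the matrix of weight differences
(`exists_partitionFunction_eq_aztecDet`). This is proved by hand: for the orientation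
`northEastSign` by counting inversions of a matching, and for all others by a gauge transformation.

In the determinant, the entry at white `(x, y)` and black `(x', y')` is `D(x, x') D(y', y) (c_{x,y'}
- d_{x,x',y})`, where `D = diffCoeff`, `c` and `d` are the weights of the even and odd columns, and
`d` depends only on `x'` when the odd columns are constant. Then `y` enters only through the vector
`D(y', ·)`. These `k + 1` vectors in dimension `k` are `e_0, e_1 - e_0, …, -e_{k-1}`; their sum is
zero, so a linear map `K = cyclicCompanion`, of determinant `(-1)^k`, permutes them cyclically.
Hence shifting the weights amounts to multiplying on the left by `1 ⊗ K` and rotating each of the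
`k` black columns. The sign is `(-1)^(k(k+1)) * (-1)^(k·k) = (-1)^k`.

For the ratios, constant signs cancel between numerator and denominator. Every face has exponent one
in the prefactor, and the partition function has degree at most one in each weight, so
homogenization commutes with the shift wherever the denominators are nonzero, and by continuity
everywhere. -/

set_option linter.unusedSectionVars false

/-! ### Oriented dimers as a permanent -/

namespace FaceGraph

variable {W B F : Type} [Fintype W] [Fintype B] [Fintype F] (G : FaceGraph W B F)

/-- The set of directed edges `(w, σ w)`, directed according to `o`. -/
def orientedGraph [DecidableEq W] [DecidableEq B] (p : (W ≃ B) × (W → Bool)) :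
    Finset (DirEdge W B) :=
  Finset.univ.image fun w => (w, p.1 w, p.2 w)

theorem mem_orientedGraph [DecidableEq W] [DecidableEq B] (p : (W ≃ B) × (W → Bool))
    (e : DirEdge W B) :
    e ∈ orientedGraph p ↔ e.2.1 = p.1 e.1 ∧ e.2.2 = p.2 e.1 := by
  obtain ⟨w, b, o⟩ := e
  simp only [orientedGraph, Finset.mem_image, Finset.mem_univ, true_and, Prod.mk.injEq]
  constructor
  · rintro ⟨w', rfl, rfl, rfl⟩
    exact ⟨rfl, rfl⟩
  · rintro ⟨rfl, rfl⟩
    exact ⟨w, rfl, rfl, rfl⟩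

theorem orientedGraph_injective [DecidableEq W] [DecidableEq B] :
    Function.Injective (orientedGraph : (W ≃ B) × (W → Bool) → Finset (DirEdge W B)) := by
  rintro ⟨σ, o⟩ ⟨σ', o'⟩ h
  have key : ∀ w, σ w = σ' w ∧ o w = o' w := fun w =>
    (mem_orientedGraph (σ', o') (w, σ w, o w)).1 (h ▸ (mem_orientedGraph (σ, o) _).2 ⟨rfl, rfl⟩)
  exact Prod.ext (Equiv.ext fun w => (key w).1) (funext fun w => (key w).2)

theorem isOrientedDimer_orientedGraph_iff [DecidableEq W] [DecidableEq B]
    (p : (W ≃ B) × (W → Bool)) :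
    G.IsOrientedDimer (orientedGraph p) ↔ ∀ w, (w, p.1 w) ∈ G.edges := by
  constructor
  · intro h w
    exact h.1 (w, p.1 w, p.2 w) ((mem_orientedGraph p _).2 ⟨rfl, rfl⟩)
  · refine fun h => ⟨fun e he => ?_, fun w => ?_, fun b => ?_⟩
    · rw [((mem_orientedGraph p e).1 he).1]
      exact h e.1
    · refine ⟨(w, p.1 w, p.2 w), ⟨(mem_orientedGraph p _).2 ⟨rfl, rfl⟩, rfl⟩, ?_⟩
      rintro ⟨w', b', o'⟩ ⟨he, rfl⟩
      obtain ⟨h1, h2⟩ := (mem_orientedGraph p _).1 he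
      simp only at h1 h2
      rw [h1, h2]
    · refine ⟨(p.1.symm b, b, p.2 (p.1.symm b)),
        ⟨(mem_orientedGraph p _).2 ⟨by simp, rfl⟩, rfl⟩, ?_⟩
      rintro ⟨w', b', o'⟩ ⟨he, rfl⟩
      obtain ⟨h1, h2⟩ := (mem_orientedGraph p _).1 he
      simp only at h1 h2
      simp [h1, h2]

theorem exists_orientedGraph_eq [DecidableEq W] [DecidableEq B] {M : Finset (DirEdge W B)}
    (hM : G.IsOrientedDimer M) : ∃ p : (W ≃ B) × (W → Bool), orientedGraph p = M := by
  obtain ⟨-, hW, hB⟩ := hM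
  choose e he heu using hW
  have hbij : Function.Bijective fun w => (e w).2.1 := by
    constructor
    · intro w w' h
      have h1 := (hB (e w).2.1).unique ⟨(he w).1, rfl⟩ ⟨(he w').1, h.symm⟩
      rw [← (he w).2, h1, (he w').2]
    · intro b
      obtain ⟨e', ⟨h1, h2⟩, -⟩ := hB b
      refine ⟨e'.1, ?_⟩
      have := heu e'.1 e' ⟨h1, rfl⟩
      simp only [← this, h2]
  refine ⟨(Equiv.ofBijective _ hbij, fun w => (e w).2.2), ?_⟩
  ext x
  rw [mem_orientedGraph]
  simp only [Equiv.ofBijective_apply]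
  constructor
  · rintro ⟨h1, h2⟩
    have : x = e x.1 := Prod.ext (he x.1).2.symm (Prod.ext h1 h2)
    rw [this]
    exact (he x.1).1
  · intro hx
    have := heu x.1 x ⟨hx, rfl⟩
    exact ⟨by rw [← this], by rw [← this]⟩

/-- The partition function of oriented dimers is the permanent of the matrix of the
`φ (w, b) (a_right - a_left)`. -/
theorem partitionFunction_eq_sum_equiv [DecidableEq W] [DecidableEq B] {R : Type} [CommRing R]
    {φ : DirEdge W B → ℤˣ}
    (hφ : ∀ w b, (w, b) ∈ G.edges → φ (w, b, false) = - φ (w, b, true)) (a : F → R) :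
    G.partitionFunction φ a = ∑ σ : W ≃ B, ∏ w, if (w, σ w) ∈ G.edges then
      ((φ (w, σ w, true) : ℤ) : R) * (a (G.rightFace w (σ w)) - a (G.leftFace w (σ w))) else 0 := by
  classical
  -- Each factor is a sum over the two directions of its edge; distributing the product gives a sum
  -- over all ways to direct the matching.
  have h1 : ∀ σ : W ≃ B, (∏ w, if (w, σ w) ∈ G.edges then
      ((φ (w, σ w, true) : ℤ) : R) * (a (G.rightFace w (σ w)) - a (G.leftFace w (σ w))) else 0)
      = ∑ o : W → Bool, ∏ w, if (w, σ w) ∈ G.edges then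
        ((φ (w, σ w, o w) : ℤ) : R) * a (G.faceOf (w, σ w, o w)) else 0 := by
    intro σ
    have := Finset.prod_univ_sum (fun _ : W => (Finset.univ : Finset Bool))
      (fun w o => if (w, σ w) ∈ G.edges then
        ((φ (w, σ w, o) : ℤ) : R) * a (G.faceOf (w, σ w, o)) else 0)
    rw [Fintype.piFinset_univ] at this
    rw [← this]
    refine Finset.prod_congr rfl fun w _ => ?_
    split_ifs with h
    · simp only [Fintype.sum_bool, hφ w _ h, faceOf]
      push_cast
      simp
      ring
    · simp
  simp_rw [h1]
  rw [← Fintype.sum_prod_type', partitionFunction, Finset.sum_filter]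
  symm
  refine Finset.sum_of_injOn orientedGraph orientedGraph_injective.injOn (by simp) ?_ ?_
  · intro M _ hM
    rw [if_neg]
    intro h
    obtain ⟨p, hp⟩ := G.exists_orientedGraph_eq h
    exact hM ⟨p, by simp, hp⟩
  · intro p _
    simp only [isOrientedDimer_orientedGraph_iff]
    split_ifs with h
    · rw [orientedGraph, Finset.prod_image fun w _ w' _ hw => congrArg Prod.fst hw]
      exact Finset.prod_congr rfl fun w _ => if_pos (h w)
    · push Not at h
      obtain ⟨w, hw⟩ := h
      exact Finset.prod_eq_zero (Finset.mem_univ w) (if_neg hw)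

theorem eval_partitionFunction (φ : DirEdge W B → ℤˣ) (a : F → ℂ) :
    MvPolynomial.eval a (G.partitionFunction φ MvPolynomial.X) = G.partitionFunction φ a := by
  simp [partitionFunction, map_sum, map_prod]

end FaceGraph

/-! ### Inversions of 0-1 sequences and of permutations -/

open Finset in
theorem two_mul_sum_sum_lt_mul {n : ℕ} (f : Fin n → ℤ) (hf : ∀ j, f j * f j = f j) :
    2 * ∑ j, ∑ j', (if j < j' then f j * f j' else 0) = (∑ j, f j) ^ 2 - ∑ j, f j := by
  have h1 : (∑ j, f j) ^ 2 = ∑ j, ∑ j', ((if j < j' then f j * f j' else 0)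
      + (if j' < j then f j' * f j else 0) + if j = j' then f j else 0) := by
    rw [sq, Finset.sum_mul_sum]
    refine sum_congr rfl fun j _ => sum_congr rfl fun j' _ => ?_
    rcases lt_trichotomy j j' with h | rfl | h
    · simp [h, h.not_gt, h.ne]
    · simp [hf]
    · simp [h, h.not_gt, h.ne', mul_comm]
  simp only [sum_add_distrib, sum_ite_eq, mem_univ, if_true] at h1
  rw [sum_comm (f := fun j j' => if j' < j then f j' * f j else 0)] at h1
  linarith

/-- A one at position `j` precedes `n - 1 - j` entries, and the pairs of ones are discarded. Once
the number of ones is fixed, the count of (one, later zero) pairs thus depends only on the sum of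
the positions of the ones. -/
theorem two_mul_sum_sum_lt {n : ℕ} (f : Fin n → ℤ) (hf : ∀ j, f j * f j = f j) :
    2 * ∑ j, ∑ j', (if j < j' then f j * (1 - f j') else 0)
      = ∑ j, 2 * ((n : ℤ) - 1 - j) * f j - ((∑ j, f j) ^ 2 - ∑ j, f j) := by
  rw [← two_mul_sum_sum_lt_mul f hf]
  have h : ∀ j : Fin n, ∑ j', (if j < j' then f j * (1 - f j') else 0)
      = ((n : ℤ) - 1 - j) * f j - ∑ j', if j < j' then f j * f j' else 0 := by
    intro j
    have h2 : ∑ j', (if j < j' then f j else 0) = ((n : ℤ) - 1 - j) * f j := by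
      rw [← Finset.sum_filter, Finset.sum_const, nsmul_eq_mul, Finset.filter_lt_eq_Ioi,
        Fin.card_Ioi]
      have := j.2
      rw [Nat.cast_sub (by omega), Nat.cast_sub (by omega)]
      simp
    rw [← h2, ← Finset.sum_sub_distrib]
    refine Finset.sum_congr rfl fun j' _ => ?_
    split_ifs <;> ring
  rw [Finset.sum_congr rfl fun j _ => h j, Finset.sum_sub_distrib, mul_sub, Finset.mul_sum]
  simp only [mul_assoc]

theorem two_mul_sum_sum_gt {n : ℕ} (f : Fin n → ℤ) (hf : ∀ j, f j * f j = f j) :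
    2 * ∑ j, ∑ j', (if j' < j then f j * (1 - f j') else 0)
      = ∑ j : Fin n, 2 * (j : ℤ) * f j - ((∑ j, f j) ^ 2 - ∑ j, f j) := by
  rw [← two_mul_sum_sum_lt_mul f hf]
  have h : ∀ j : Fin n, ∑ j', (if j' < j then f j * (1 - f j') else 0)
      = (j : ℤ) * f j - ∑ j', if j' < j then f j' * f j else 0 := by
    intro j
    have h2 : ∑ j', (if j' < j then f j else 0) = (j : ℤ) * f j := by
      rw [← Finset.sum_filter, Finset.sum_const, nsmul_eq_mul, Finset.filter_gt_eq_Iio,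
        Fin.card_Iio]
    rw [← h2, ← Finset.sum_sub_distrib]
    refine Finset.sum_congr rfl fun j' _ => ?_
    split_ifs <;> ring
  rw [Finset.sum_congr rfl fun j _ => h j, Finset.sum_sub_distrib, mul_sub, Finset.mul_sum,
    Finset.sum_comm (f := fun j j' => if j' < j then f j' * f j else 0)]
  simp only [mul_assoc]

/-- The sign of a permutation is the parity of its number of inversions. -/
theorem sign_eq_neg_one_pow_card_inversions {n : ℕ} (π : Equiv.Perm (Fin n)) :
    Equiv.Perm.sign π
      = (-1) ^ (Finset.univ.filter fun p : Fin n × Fin n => p.1 < p.2 ∧ π p.2 < π p.1).card := by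
  rw [Equiv.Perm.sign_eq_prod_prod_Iio, Finset.card_filter, ← Finset.prod_pow_eq_pow_sum,
    Fintype.prod_prod_type_right]
  refine Finset.prod_congr rfl fun j _ => ?_
  rw [← Finset.filter_gt_eq_Iio, Finset.prod_filter]
  refine Finset.prod_congr rfl fun i _ => ?_
  by_cases h : i < j
  · have : π i ≠ π j := fun hh => h.ne (π.injective hh)
    by_cases h2 : π i < π j
    · simp [h, h2, h2.not_gt]
    · simp [h, h2, lt_of_le_of_ne (not_lt.1 h2) this.symm]
  · simp [h]

theorem finProdFinEquiv_lt_iff {m n : ℕ} (x y : Fin m × Fin n) :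
    finProdFinEquiv x < finProdFinEquiv y ↔
      x.1.val < y.1.val ∨ (x.1.val = y.1.val ∧ x.2.val < y.2.val) := by
  obtain ⟨⟨a, ha⟩, ⟨b, hb⟩⟩ := x
  obtain ⟨⟨c, hc⟩, ⟨d, hd⟩⟩ := y
  rw [Fin.lt_def, finProdFinEquiv_apply_val, finProdFinEquiv_apply_val]
  simp only
  rcases lt_trichotomy a c with h | rfl | h
  · simp only [h, true_or, iff_true]
    nlinarith
  · simp
  · have : ¬ (b + n * a < d + n * c) := by nlinarith
    simp only [this, false_iff]
    omega

/-! ### Kasteleyn's sign for the north-east orientation -/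

/-- The column by column enumeration of the white vertices. -/
def aztecWhiteIndex (k : ℕ) : AztecWhite k ≃ Fin ((k + 1) * k) := finProdFinEquiv

/-- The column by column enumeration of the black vertices. -/
def aztecBlackIndex (k : ℕ) : AztecBlack k ≃ Fin ((k + 1) * k) :=
  finProdFinEquiv.trans (finCongr (Nat.mul_comm _ _))

theorem aztecWhiteIndex_lt_iff {k : ℕ} (x y : AztecWhite k) :
    aztecWhiteIndex k x < aztecWhiteIndex k y ↔
      x.1.val < y.1.val ∨ (x.1.val = y.1.val ∧ x.2.val < y.2.val) :=
  finProdFinEquiv_lt_iff x y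

theorem aztecBlackIndex_lt_iff {k : ℕ} (x y : AztecBlack k) :
    aztecBlackIndex k x < aztecBlackIndex k y ↔
      x.1.val < y.1.val ∨ (x.1.val = y.1.val ∧ x.2.val < y.2.val) :=
  finProdFinEquiv_lt_iff x y

/-- The identification of the white and the black vertices by their enumerations. -/
def aztecIndex (k : ℕ) : AztecWhite k ≃ AztecBlack k :=
  (aztecWhiteIndex k).trans (aztecBlackIndex k).symm

theorem mem_aztec_edges {k : ℕ} (w : AztecWhite k) (b : AztecBlack k) :
    (w, b) ∈ (aztec k).edges ↔ (b.1.val = w.1.val ∨ b.1.val + 1 = w.1.val) ∧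
      (b.2.val = w.2.val + 1 ∨ b.2.val = w.2.val) := by
  unfold aztec
  simp only [Finset.mem_filter, Finset.mem_univ, true_and]
  rfl

section Matching

variable {k : ℕ} (σ : AztecWhite k ≃ AztecBlack k)

/-- The sign of a matching is the parity of its number of inversions. -/
theorem sign_matching : Equiv.Perm.sign (σ.trans (aztecIndex k).symm)
    = (-1) ^ (Finset.univ.filter fun p : AztecWhite k × AztecWhite k =>
      aztecWhiteIndex k p.1 < aztecWhiteIndex k p.2 ∧
        aztecBlackIndex k (σ p.2) < aztecBlackIndex k (σ p.1)).card := by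
  have h1 : σ.trans (aztecIndex k).symm
      = ((aztecWhiteIndex k).trans (((aztecWhiteIndex k).symm.trans
        (σ.trans (aztecBlackIndex k))))).trans (aztecWhiteIndex k).symm := by
    ext w : 1
    simp [aztecIndex]
  rw [h1]
  have h2 := Equiv.Perm.sign_symm_trans_trans
    ((aztecWhiteIndex k).symm.trans (σ.trans (aztecBlackIndex k))) (aztecWhiteIndex k).symm
  rw [Equiv.symm_symm] at h2
  rw [h2, sign_eq_neg_one_pow_card_inversions]
  congr 1
  symm
  refine Finset.card_equiv ((aztecWhiteIndex k).prodCongr (aztecWhiteIndex k)) fun p => ?_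
  simp only [Finset.mem_filter, Finset.mem_univ, true_and]
  simp

/-- The indicator function of the white vertices matched to the east. -/
def eastInd (w : AztecWhite k) : ℤ := if (σ w).1.val = w.1.val then 1 else 0

theorem eastInd_mul_self (w : AztecWhite k) : eastInd σ w * eastInd σ w = eastInd σ w := by
  unfold eastInd; split_ifs <;> rfl

/-- A white vertex matched to the east has its partner in the black column of the same index, so `σ`
carries one count to the other. -/
theorem sum_eastInd_black (i : Fin k) :
    ∑ l, eastInd σ (σ.symm (i, l)) = ∑ j, eastInd σ (i.castSucc, j) := by
  have h1 : ∑ l, eastInd σ (σ.symm (i, l))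
      = ∑ b : AztecBlack k, if b.1 = i then eastInd σ (σ.symm b) else 0 := by
    rw [Fintype.sum_prod_type, Finset.sum_eq_single i] <;> simp +contextual
  have h2 : ∑ j, eastInd σ (i.castSucc, j)
      = ∑ w : AztecWhite k, if w.1 = i.castSucc then eastInd σ w else 0 := by
    rw [Fintype.sum_prod_type, Finset.sum_eq_single i.castSucc] <;> simp +contextual
  rw [h1, h2, ← Equiv.sum_comp σ]
  refine Finset.sum_congr rfl fun w _ => ?_
  rw [Equiv.symm_apply_apply]
  by_cases h : (σ w).1.val = w.1.val
  · simp [Fin.ext_iff, h]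
  · simp [eastInd, h]

variable (hσ : ∀ w, (w, σ w) ∈ (aztec k).edges)

include hσ

theorem sum_westInd_black (i : Fin k) :
    ∑ l, (1 - eastInd σ (σ.symm (i, l))) = ∑ j, (1 - eastInd σ (i.succ, j)) := by
  have h1 : ∑ l, (1 - eastInd σ (σ.symm (i, l)))
      = ∑ b : AztecBlack k, if b.1 = i then (1 - eastInd σ (σ.symm b)) else 0 := by
    rw [Fintype.sum_prod_type, Finset.sum_eq_single i] <;> simp +contextual
  have h2 : ∑ j, (1 - eastInd σ (i.succ, j))
      = ∑ w : AztecWhite k, if w.1 = i.succ then (1 - eastInd σ w) else 0 := by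
    rw [Fintype.sum_prod_type, Finset.sum_eq_single i.succ] <;> simp +contextual
  rw [h1, h2, ← Equiv.sum_comp σ]
  refine Finset.sum_congr rfl fun w _ => ?_
  rw [Equiv.symm_apply_apply]
  by_cases h : (σ w).1.val = w.1.val
  · simp [eastInd, h]
  · have h3 : (σ w).1.val + 1 = w.1.val :=
      (((mem_aztec_edges w (σ w)).1 (hσ w)).1).resolve_left h
    simp [Fin.ext_iff, ← h3]

/-- The `k + 1` vertices of black column `i` are matched to white column `i` or `i + 1`. This
determines the count column by column, starting from the leftmost one, where every edge goes east.
-/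
theorem sum_eastInd (i : Fin (k + 1)) : ∑ j, eastInd σ (i, j) = (k : ℤ) - i := by
  induction i using Fin.induction with
  | zero =>
    have : ∀ j : Fin k, eastInd σ (0, j) = 1 := fun j => by
      have := ((mem_aztec_edges _ _).1 (hσ (0, j))).1
      simp only [Fin.val_zero, Nat.add_eq_zero_iff, one_ne_zero, and_false, or_false] at this
      simp [eastInd, this]
    simp [this]
  | succ i ih =>
    have h1 := sum_eastInd_black σ i
    have h2 := sum_westInd_black σ hσ i
    simp only [Finset.sum_sub_distrib, Finset.sum_const, Finset.card_univ, Fintype.card_fin,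
      nsmul_eq_mul, mul_one] at h2
    simp only [Fin.val_castSucc, Fin.val_succ] at ih ⊢
    push_cast at h2 ⊢
    linarith

/-- The inversions of a matching are of two kinds: those between white vertices of the same column
and those between black vertices of the same column. -/
theorem card_inversions :
    (((Finset.univ.filter fun p : AztecWhite k × AztecWhite k =>
      aztecWhiteIndex k p.1 < aztecWhiteIndex k p.2 ∧
        aztecBlackIndex k (σ p.2) < aztecBlackIndex k (σ p.1)).card : ℕ) : ℤ)
    = (∑ i, ∑ j, ∑ j', if j < j' then eastInd σ (i, j) * (1 - eastInd σ (i, j')) else 0)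
      + ∑ i, ∑ l, ∑ l', if l' < l then
        eastInd σ (σ.symm (i, l)) * (1 - eastInd σ (σ.symm (i, l'))) else 0 := by
  have h1 : (∑ i, ∑ j, ∑ j', if j < j' then eastInd σ (i, j) * (1 - eastInd σ (i, j')) else 0)
      = ∑ w : AztecWhite k, ∑ w' : AztecWhite k, if w.1 = w'.1 ∧ w.2 < w'.2 then
        eastInd σ w * (1 - eastInd σ w') else 0 := by
    rw [Fintype.sum_prod_type]
    refine Finset.sum_congr rfl fun i _ => Finset.sum_congr rfl fun j _ => ?_
    rw [Fintype.sum_prod_type, Finset.sum_eq_single i]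
    · simp
    · intro i' _ h
      simp [h.symm]
    · simp
  have h2 : (∑ i, ∑ l, ∑ l', if l' < l then
        eastInd σ (σ.symm (i, l)) * (1 - eastInd σ (σ.symm (i, l'))) else 0)
      = ∑ b : AztecBlack k, ∑ b' : AztecBlack k, if b.1 = b'.1 ∧ b'.2 < b.2 then
        eastInd σ (σ.symm b) * (1 - eastInd σ (σ.symm b')) else 0 := by
    rw [Fintype.sum_prod_type]
    refine Finset.sum_congr rfl fun i _ => Finset.sum_congr rfl fun j _ => ?_
    rw [Fintype.sum_prod_type, Finset.sum_eq_single i]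
    · simp
    · intro i' _ h
      simp [h.symm]
    · simp
  rw [h1, h2, ← Equiv.sum_comp σ, ← Finset.sum_add_distrib, Finset.card_filter,
    Fintype.sum_prod_type, Nat.cast_sum]
  refine Finset.sum_congr rfl fun w _ => ?_
  rw [← Equiv.sum_comp σ, ← Finset.sum_add_distrib, Nat.cast_sum]
  refine Finset.sum_congr rfl fun w' _ => ?_
  have e := (mem_aztec_edges _ _).1 (hσ w)
  have e' := (mem_aztec_edges _ _).1 (hσ w')
  simp only [aztecWhiteIndex_lt_iff, aztecBlackIndex_lt_iff, eastInd, Equiv.symm_apply_apply]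
  simp only [Fin.ext_iff, Fin.lt_def]
  -- Two edges going to the same side never cross, nor do a west edge at `w` and an east edge at a
  -- later `w'`. An east edge at `w` and a west edge at `w'` are inverted in two cases: same white
  -- column with `w` below `w'`, or same black column with `σ w'` below `σ w`.
  by_cases hE : (σ w).1.val = w.1.val <;> by_cases hE' : (σ w').1.val = w'.1.val
  · simp only [hE, hE', if_true, sub_self, mul_zero, ite_self, add_zero, Nat.cast_eq_zero,
      ite_eq_right_iff, one_ne_zero, imp_false]
    omega
  · have e1 := e'.1.resolve_left hE'
    simp only [hE, hE', if_true, if_false, sub_zero, mul_one]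
    by_cases hc : w.1.val = w'.1.val
    · rw [if_neg (c := _ ∧ (σ w').2.val < (σ w).2.val) (by omega)]
      by_cases hd : w.2.val < w'.2.val
      · rw [if_pos (by omega), if_pos (by omega)]; rfl
      · rw [if_neg (by omega), if_neg (by omega)]; rfl
    · rw [if_neg (c := _ ∧ w.2.val < w'.2.val) (by omega)]
      by_cases hd : w.1.val = (σ w').1.val ∧ (σ w').2.val < (σ w).2.val
      · rw [if_pos (by omega), if_pos (by omega)]; rfl
      · rw [if_neg (by omega), if_neg (by omega)]; rfl
  · simp only [hE, hE', if_true, if_false, zero_mul, ite_self, add_zero, Nat.cast_eq_zero,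
      ite_eq_right_iff, one_ne_zero, imp_false]
    omega
  · simp only [hE, hE', if_false, zero_mul, ite_self, add_zero, Nat.cast_eq_zero,
      ite_eq_right_iff, one_ne_zero, imp_false]
    omega

/-- Up to a constant, the inversions of a matching are as many as its edges that go from a white
vertex to the north-east. -/
theorem two_mul_card_inversions :
    2 * (((Finset.univ.filter fun p : AztecWhite k × AztecWhite k =>
      aztecWhiteIndex k p.1 < aztecWhiteIndex k p.2 ∧
        aztecBlackIndex k (σ p.2) < aztecBlackIndex k (σ p.1)).card : ℕ) : ℤ)
    = 2 * (((Finset.univ.filter fun w : AztecWhite k =>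
        (σ w).1.val = w.1.val ∧ (σ w).2.val = w.2.val + 1).card : ℕ) : ℤ)
      + (2 * (k - 1) * ∑ i : Fin (k + 1), ((k : ℤ) - i)
        - (∑ i : Fin (k + 1), (((k : ℤ) - i) ^ 2 - ((k : ℤ) - i))
          + ∑ i : Fin k, (((k : ℤ) - i) ^ 2 - ((k : ℤ) - i)))) := by
  have hb : ∀ i : Fin k, ∑ l, eastInd σ (σ.symm (i, l)) = (k : ℤ) - i := fun i => by
    rw [sum_eastInd_black σ, sum_eastInd σ hσ]; rfl
  rw [card_inversions σ hσ, mul_add, Finset.mul_sum, Finset.mul_sum]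
  simp_rw [fun i => two_mul_sum_sum_lt (fun j => eastInd σ (i, j)) fun j => eastInd_mul_self σ _,
    fun i => two_mul_sum_sum_gt (fun l => eastInd σ (σ.symm (i, l))) fun j => eastInd_mul_self σ _,
    hb, sum_eastInd σ hσ, Finset.sum_sub_distrib]
  have h1 : ∑ i : Fin k, ∑ l : Fin (k + 1), 2 * (l : ℤ) * eastInd σ (σ.symm (i, l))
      = ∑ w : AztecWhite k, 2 * ((σ w).2 : ℤ) * eastInd σ w := by
    rw [← Fintype.sum_prod_type (fun b : AztecBlack k => 2 * (b.2 : ℤ) * eastInd σ (σ.symm b)),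
      ← Equiv.sum_comp σ]
    simp
  have h2 : ∑ i : Fin (k + 1), ∑ j : Fin k, 2 * ((k : ℤ) - 1 - j) * eastInd σ (i, j)
      = ∑ w : AztecWhite k, 2 * ((k : ℤ) - 1 - w.2) * eastInd σ w := by
    rw [Fintype.sum_prod_type]
  have h3 : ∑ i : Fin (k + 1), ((k : ℤ) - i) = ∑ w : AztecWhite k, eastInd σ w := by
    rw [Fintype.sum_prod_type]
    simp_rw [sum_eastInd σ hσ]
  -- The heights of the two ends of an east edge differ by one if it goes north and by zero if it
  -- goes south; their difference counts the north-east edges.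
  have h4 : ∑ w : AztecWhite k, 2 * ((σ w).2 : ℤ) * eastInd σ w
      + ∑ w : AztecWhite k, 2 * ((k : ℤ) - 1 - w.2) * eastInd σ w
      = 2 * (((Finset.univ.filter fun w : AztecWhite k =>
        (σ w).1.val = w.1.val ∧ (σ w).2.val = w.2.val + 1).card : ℕ) : ℤ)
        + 2 * (k - 1) * ∑ w : AztecWhite k, eastInd σ w := by
    rw [Finset.card_filter, Nat.cast_sum, Finset.mul_sum, Finset.mul_sum,
      ← Finset.sum_add_distrib, ← Finset.sum_add_distrib]
    refine Finset.sum_congr rfl fun w _ => ?_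
    have e := (mem_aztec_edges _ _).1 (hσ w)
    simp only [eastInd]
    by_cases hE : (σ w).1.val = w.1.val
    · rcases e.2 with h | h
      · simp only [hE, h, if_true, and_self]
        push_cast
        ring
      · simp only [hE, h, if_true]
        simp
        ring
    · simp [hE]
  simp only [Finset.sum_sub_distrib] at h3 h4 ⊢
  rw [h1, h2]
  rw [← h3] at h4
  linarith

end Matching

/-- The Kasteleyn orientation which is `-1` exactly on the edges that go from a white vertex to
the north-east. -/
def northEastSign {k : ℕ} (w : AztecWhite k) (b : AztecBlack k) : ℤˣ :=
  if b.1.val = w.1.val ∧ b.2.val = w.2.val + 1 then -1 else 1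

/-- Kasteleyn's theorem for `northEastSign`. -/
theorem exists_prod_northEastSign (k : ℕ) : ∃ κ : ℤˣ, ∀ σ : AztecWhite k ≃ AztecBlack k,
    (∀ w, (w, σ w) ∈ (aztec k).edges) →
      ∏ w, northEastSign w (σ w) = κ * Equiv.Perm.sign (σ.trans (aztecIndex k).symm) := by
  have h : ∀ σ : AztecWhite k ≃ AztecBlack k, ∏ w, northEastSign w (σ w)
      = (-1) ^ (Finset.univ.filter fun w : AztecWhite k =>
        (σ w).1.val = w.1.val ∧ (σ w).2.val = w.2.val + 1).card := by
    intro σ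
    rw [Finset.card_filter, ← Finset.prod_pow_eq_pow_sum]
    refine Finset.prod_congr rfl fun w _ => ?_
    unfold northEastSign
    split_ifs <;> simp
  by_cases hτ : ∃ τ : AztecWhite k ≃ AztecBlack k, ∀ w, (w, τ w) ∈ (aztec k).edges
  · obtain ⟨τ, hτ⟩ := hτ
    -- The constant is read off from a reference matching `τ`: inversions minus north-east edges is
    -- the same number for all matchings.
    refine ⟨(∏ w, northEastSign w (τ w)) * Equiv.Perm.sign (τ.trans (aztecIndex k).symm), ?_⟩
    intro σ hσ
    have h1 := two_mul_card_inversions τ hτ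
    have h2 := two_mul_card_inversions σ hσ
    rw [sign_matching, sign_matching, h, h, ← pow_add, ← pow_add]
    refine neg_one_pow_congr ?_
    rw [← Int.even_coe_nat, ← Int.even_coe_nat]
    push_cast
    grind
  · exact ⟨1, fun σ hσ => absurd ⟨σ, hσ⟩ hτ⟩

/-! ### Faces of the Aztec diamond: boundaries, degrees, exponents -/

theorem FaceGraph.mem_boundary {W B F : Type} (G : FaceGraph W B F) (f : F) (e : W × B) :
    e ∈ G.boundary f ↔
      e ∈ G.edges ∧ (G.rightFace e.1 e.2 = f ∨ G.leftFace e.1 e.2 = f) :=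
  @Finset.mem_filter _ _ (_) _ _

theorem aztec_rightFace {k : ℕ} (w : AztecWhite k) (b : AztecBlack k) :
    (aztec k).rightFace w b = if (b.1.val = w.1.val ↔ b.2.val = w.2.val + 1) then
      Sum.inr (b.1, w.2) else Sum.inl (w.1, b.2) :=
  @if_congr _ _ _ (_) _ _ _ _ _ Iff.rfl rfl rfl

theorem aztec_leftFace {k : ℕ} (w : AztecWhite k) (b : AztecBlack k) :
    (aztec k).leftFace w b = if (b.1.val = w.1.val ↔ b.2.val = w.2.val + 1) then
      Sum.inl (w.1, b.2) else Sum.inr (b.1, w.2) :=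
  @if_congr _ _ _ (_) _ _ _ _ _ Iff.rfl rfl rfl

theorem mem_aztec_boundary_inl {k : ℕ} (i j : Fin (k + 1)) (e : AztecWhite k × AztecBlack k) :
    e ∈ (aztec k).boundary (Sum.inl (i, j)) ↔
      e ∈ (aztec k).edges ∧ e.1.1 = i ∧ e.2.2 = j := by
  rw [FaceGraph.mem_boundary, aztec_rightFace, aztec_leftFace]
  refine and_congr_right fun _ => ?_
  split_ifs <;> simp

theorem mem_aztec_boundary_inr {k : ℕ} (i j : Fin k) (e : AztecWhite k × AztecBlack k) :
    e ∈ (aztec k).boundary (Sum.inr (i, j)) ↔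
      e ∈ (aztec k).edges ∧ e.2.1 = i ∧ e.1.2 = j := by
  rw [FaceGraph.mem_boundary, aztec_rightFace, aztec_leftFace]
  refine and_congr_right fun _ => ?_
  split_ifs <;> simp

theorem aztec_boundary_inr {k : ℕ} (i j : Fin k) :
    (aztec k).boundary (Sum.inr (i, j)) =
      (({i.castSucc, i.succ} : Finset (Fin (k + 1))) ×ˢ ({j} : Finset (Fin k))) ×ˢ
        (({i} : Finset (Fin k)) ×ˢ ({j.castSucc, j.succ} : Finset (Fin (k + 1)))) := by
  ext ⟨⟨x, y⟩, ⟨x', y'⟩⟩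
  rw [mem_aztec_boundary_inr, mem_aztec_edges]
  simp only [Finset.mem_product, Finset.mem_insert, Finset.mem_singleton, Fin.ext_iff,
    Fin.val_castSucc, Fin.val_succ]
  omega

theorem aztec_boundary_inl {k : ℕ} (i j : Fin (k + 1)) :
    (aztec k).boundary (Sum.inl (i, j)) =
      ({i} ×ˢ Finset.univ.filter fun y : Fin k => y.val = j.val ∨ y.val + 1 = j.val) ×ˢ
      ((Finset.univ.filter fun x : Fin k => x.val = i.val ∨ x.val + 1 = i.val) ×ˢ {j}) := by
  ext ⟨⟨x, y⟩, ⟨x', y'⟩⟩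
  rw [mem_aztec_boundary_inl, mem_aztec_edges]
  simp only [Finset.mem_product, Finset.mem_filter, Finset.mem_univ, true_and,
    Finset.mem_singleton, Fin.ext_iff]
  omega

theorem filter_adjacent_eq_pair {k i : ℕ} (hi : i + 1 < k) :
    (Finset.univ.filter fun x : Fin k => x.val = i + 1 ∨ x.val + 1 = i + 1)
      = {⟨i, by omega⟩, ⟨i + 1, hi⟩} := by
  ext x
  simp only [Finset.mem_filter, Finset.mem_univ, true_and, Finset.mem_insert,
    Finset.mem_singleton, Fin.ext_iff]
  omega

theorem card_filter_adjacent {k : ℕ} (hk : 1 ≤ k) (i : Fin (k + 1)) :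
    (Finset.univ.filter fun x : Fin k => x.val = i.val ∨ x.val + 1 = i.val).card
      = if 0 < i.val ∧ i.val < k then 2 else 1 := by
  obtain ⟨i, hi⟩ := i
  simp only
  split_ifs with h
  · obtain ⟨i, rfl⟩ := Nat.exists_eq_succ_of_ne_zero h.1.ne'
    rw [Nat.succ_eq_add_one, filter_adjacent_eq_pair h.2, Finset.card_pair (by simp)]
  · rw [Finset.card_eq_one]
    refine ⟨⟨i - 1, by omega⟩, ?_⟩
    ext x
    simp only [Finset.mem_filter, Finset.mem_univ, true_and, Finset.mem_singleton, Fin.ext_iff]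
    omega

theorem inl_mem_innerFaces {k : ℕ} (i j : Fin (k + 1)) :
    Sum.inl (i, j) ∈ (aztec k).innerFaces ↔ 0 < i.val ∧ i.val < k ∧ 0 < j.val ∧ j.val < k := by
  simp [aztec]

theorem inr_mem_innerFaces {k : ℕ} (i j : Fin k) : Sum.inr (i, j) ∈ (aztec k).innerFaces := by
  simp [aztec]

theorem aztec_faceDegree_inr {k : ℕ} (i j : Fin k) :
    (aztec k).faceDegree (Sum.inr (i, j)) = 4 := by
  rw [FaceGraph.faceDegree, aztec_boundary_inr]
  simp only [Finset.card_product, Finset.card_singleton]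
  rw [Finset.card_pair (by simp [Fin.ext_iff]), Finset.card_pair (by simp [Fin.ext_iff])]

theorem aztec_faceDegree_inl {k : ℕ} (hk : 1 ≤ k) (i j : Fin (k + 1)) :
    (aztec k).faceDegree (Sum.inl (i, j)) =
      (if 0 < j.val ∧ j.val < k then 2 else 1) * (if 0 < i.val ∧ i.val < k then 2 else 1) := by
  rw [FaceGraph.faceDegree, aztec_boundary_inl]
  simp only [Finset.card_product, Finset.card_singleton, card_filter_adjacent hk, one_mul, mul_one]

/-- In the prefactor of the ratio function of the Aztec diamond, every weight has exponent one. -/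
theorem aztec_faceExponent {k : ℕ} (hk : 1 ≤ k) (f : AztecFace k) :
    (aztec k).faceExponent f = 1 := by
  rcases f with ⟨i, j⟩ | ⟨i, j⟩
  · rw [FaceGraph.faceExponent, aztec_faceDegree_inl hk]
    simp only [inl_mem_innerFaces]
    split_ifs <;> first | rfl | omega
  · rw [FaceGraph.faceExponent, aztec_faceDegree_inr, if_pos (inr_mem_innerFaces i j)]

/-! ### Gauge equivalence of Kasteleyn orientations -/

section Gauge

variable (ψ : ℕ → ℕ → ℕ → ℕ → ℤˣ)

/-- The gauge at the white vertex `(i, j)` of a sign function `ψ` on the edges. -/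
def whiteGauge : ℕ → ℕ → ℤˣ
  | 0, 0 => 1
  | i + 1, 0 => whiteGauge i 0 * ψ i 0 i 0 * ψ (i + 1) 0 i 0
  | 0, j + 1 => whiteGauge 0 j * ψ 0 j 0 (j + 1) * ψ 0 (j + 1) 0 (j + 1)
  | i + 1, j + 1 => whiteGauge i j * ψ i j i (j + 1) * ψ (i + 1) (j + 1) i (j + 1)

/-- The gauge at the black vertex `(i, j)` of a sign function `ψ` on the edges. -/
def blackGauge : ℕ → ℕ → ℤˣ
  | i, 0 => whiteGauge ψ i 0 * ψ i 0 i 0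
  | i, j + 1 => whiteGauge ψ i j * ψ i j i (j + 1)

theorem units_mul_self_mul (u v : ℤˣ) : u * (u * v) = v := by
  rw [← mul_assoc, Int.units_mul_self, one_mul]

theorem units_eq_of_mul_eq_one {a b c d : ℤˣ} (h : a * b * (c * d) = 1) : d = a * b * c := by
  rw [← mul_assoc] at h
  rw [eq_comm, ← mul_one (a * b * c), ← Int.units_mul_self d, ← mul_assoc, h, one_mul]

/-- The gauge is integrated along a spanning tree: all north-east and south-west edges, and the
south-east edges of the bottom row and of the left column. On tree edges the identity holds by
construction; the face relations propagate it to the others. -/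
theorem eq_gauge_northEast (i j : ℕ) :
    ψ i j i (j + 1) = whiteGauge ψ i j * blackGauge ψ i (j + 1) := by
  simp only [blackGauge, units_mul_self_mul]

theorem eq_gauge_southWest (i j : ℕ) :
    ψ (i + 1) j i j = whiteGauge ψ (i + 1) j * blackGauge ψ i j := by
  rcases j with _ | j
  all_goals
    rw [whiteGauge, blackGauge, mul_right_comm, Int.units_mul_self, one_mul]

variable {k : ℕ}
  (h1 : ∀ i j, i < k → j < k →
    ψ i j i j * ψ i j i (j + 1) * (ψ (i + 1) j i j * ψ (i + 1) j i (j + 1)) = 1)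
  (h2 : ∀ i j, i + 1 < k → j + 1 < k →
    ψ (i + 1) j i (j + 1) * ψ (i + 1) j (i + 1) (j + 1) *
      (ψ (i + 1) (j + 1) i (j + 1) * ψ (i + 1) (j + 1) (i + 1) (j + 1)) = 1)

include h1

theorem eq_gauge_northWest_of_southEast (i j : ℕ) (hi : i < k) (hj : j < k)
    (h : ψ i j i j = whiteGauge ψ i j * blackGauge ψ i j) :
    ψ (i + 1) j i (j + 1) = whiteGauge ψ (i + 1) j * blackGauge ψ i (j + 1) := by
  rw [units_eq_of_mul_eq_one (h1 i j hi hj), h, eq_gauge_northEast ψ, eq_gauge_southWest ψ]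
  simp only [mul_comm, mul_left_comm, mul_assoc, units_mul_self_mul]

include h2

/-- Away from the tree, the inner even-column face below and to the right of nothing but known edges
determines the sign: its north-west edge is known from the odd-column face one step down the
antidiagonal direction, by induction on `j`. -/
theorem eq_gauge_southEast (i j : ℕ) (hi : i < k) (hj : j < k) :
    ψ i j i j = whiteGauge ψ i j * blackGauge ψ i j := by
  induction j generalizing i with
  | zero => simp only [blackGauge, units_mul_self_mul]
  | succ j ih =>
    rcases i with _ | i
    · rw [whiteGauge, blackGauge, mul_right_comm, Int.units_mul_self, one_mul]
    · rw [units_eq_of_mul_eq_one (h2 i j hi hj), eq_gauge_southWest ψ, eq_gauge_northEast ψ,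
        eq_gauge_northWest_of_southEast ψ h1 i j (by omega) (by omega)
          (ih i (by omega) (by omega))]
      simp only [mul_comm, mul_left_comm, units_mul_self_mul, Int.units_mul_self, mul_one]

theorem eq_gauge_northWest (i j : ℕ) (hi : i < k) (hj : j < k) :
    ψ (i + 1) j i (j + 1) = whiteGauge ψ (i + 1) j * blackGauge ψ i (j + 1) :=
  eq_gauge_northWest_of_southEast ψ h1 i j hi hj (eq_gauge_southEast ψ h1 h2 i j hi hj)

end Gauge

/-- Every Kasteleyn orientation is gauge equivalent to `northEastSign`. -/
theorem exists_gauge {k : ℕ} (hk : 1 ≤ k) {φ : DirEdge (AztecWhite k) (AztecBlack k) → ℤˣ}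
    (hφ : (aztec k).IsKasteleyn φ) :
    ∃ (g : AztecWhite k → ℤˣ) (h : AztecBlack k → ℤˣ), ∀ w b, (w, b) ∈ (aztec k).edges →
      φ (w, b, true) = g w * h b * northEastSign w b := by
  -- The quotient of `φ` by `northEastSign`, which is its own inverse. An inner face has degree 4,
  -- so `φ` has product `-1` around it, and exactly one of its edges is north-east; hence `ψ` has
  -- product `1`.
  let ψ : ℕ → ℕ → ℕ → ℕ → ℤˣ := fun x y x' y' =>
    if hb : (x < k + 1 ∧ y < k) ∧ (x' < k ∧ y' < k + 1) then
      φ ((⟨x, hb.1.1⟩, ⟨y, hb.1.2⟩), (⟨x', hb.2.1⟩, ⟨y', hb.2.2⟩), true) *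
        northEastSign (⟨x, hb.1.1⟩, ⟨y, hb.1.2⟩) (⟨x', hb.2.1⟩, ⟨y', hb.2.2⟩) else 1
  have hψ : ∀ x y x' y' (hx : x < k + 1) (hy : y < k) (hx' : x' < k) (hy' : y' < k + 1),
      ψ x y x' y' = φ ((⟨x, hx⟩, ⟨y, hy⟩), (⟨x', hx'⟩, ⟨y', hy'⟩), true) *
        northEastSign (⟨x, hx⟩, ⟨y, hy⟩) (⟨x', hx'⟩, ⟨y', hy'⟩) := by
    intro x y x' y' hx hy hx' hy'
    exact dif_pos ⟨⟨hx, hy⟩, ⟨hx', hy'⟩⟩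
  have h1 : ∀ i j, i < k → j < k →
      ψ i j i j * ψ i j i (j + 1) * (ψ (i + 1) j i j * ψ (i + 1) j i (j + 1)) = 1 := by
    intro i j hi hj
    have hf := hφ.face (Sum.inr (⟨i, hi⟩, ⟨j, hj⟩)) (inr_mem_innerFaces _ _)
    rw [aztec_faceDegree_inr, aztec_boundary_inr, Finset.prod_product, Finset.prod_product,
      Finset.prod_pair (by simp [Fin.ext_iff])] at hf
    simp only [Finset.prod_product, Finset.prod_singleton] at hf
    rw [Finset.prod_pair (by simp [Fin.ext_iff]), Finset.prod_pair (by simp [Fin.ext_iff])] at hf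
    rw [hψ i j i j (by omega) hj hi (by omega), hψ i j i (j + 1) (by omega) hj hi (by omega),
      hψ (i + 1) j i j (by omega) hj hi (by omega),
      hψ (i + 1) j i (j + 1) (by omega) hj hi (by omega)]
    simp only [northEastSign]
    simp only [Fin.castSucc_mk, Fin.succ_mk] at hf
    simp
    rw [hf]
    rfl
  have h2 : ∀ i j, i + 1 < k → j + 1 < k →
      ψ (i + 1) j i (j + 1) * ψ (i + 1) j (i + 1) (j + 1) *
        (ψ (i + 1) (j + 1) i (j + 1) * ψ (i + 1) (j + 1) (i + 1) (j + 1)) = 1 := by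
    intro i j hi hj
    have hf := hφ.face (Sum.inl (⟨i + 1, by omega⟩, ⟨j + 1, by omega⟩))
      ((inl_mem_innerFaces _ _).2 ⟨by simp, hi, by simp, hj⟩)
    rw [aztec_faceDegree_inl hk, if_pos ⟨by simp, hj⟩, if_pos ⟨by simp, hi⟩, aztec_boundary_inl,
      filter_adjacent_eq_pair hi, filter_adjacent_eq_pair hj,
      Finset.prod_product, Finset.prod_product] at hf
    simp only [Finset.prod_singleton] at hf
    rw [Finset.prod_pair (by simp [Fin.ext_iff])] at hf
    simp only [Finset.prod_product, Finset.prod_singleton] at hf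
    rw [Finset.prod_pair (by simp [Fin.ext_iff]), Finset.prod_pair (by simp [Fin.ext_iff])] at hf
    rw [hψ (i + 1) j i (j + 1) (by omega) (by omega) (by omega) (by omega),
      hψ (i + 1) j (i + 1) (j + 1) (by omega) (by omega) (by omega) (by omega),
      hψ (i + 1) (j + 1) i (j + 1) (by omega) (by omega) (by omega) (by omega),
      hψ (i + 1) (j + 1) (i + 1) (j + 1) (by omega) (by omega) (by omega) (by omega)]
    simp only [northEastSign]
    simp
    rw [hf]
    rfl
  refine ⟨fun w => whiteGauge ψ w.1 w.2, fun b => blackGauge ψ b.1 b.2, ?_⟩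
  rintro ⟨⟨x, hx⟩, ⟨y, hy⟩⟩ ⟨⟨x', hx'⟩, ⟨y', hy'⟩⟩ he
  rw [mem_aztec_edges] at he
  have key : ψ x y x' y' = whiteGauge ψ x y * blackGauge ψ x' y' := by
    simp only at he
    obtain ⟨rfl | rfl, rfl | rfl⟩ := he
    · exact eq_gauge_northEast ψ _ _
    · exact eq_gauge_southEast ψ h1 h2 _ _ hx' hy
    · exact eq_gauge_northWest ψ h1 h2 _ _ hx' hy
    · exact eq_gauge_southWest ψ _ _
  rw [hψ x y x' y' hx hy hx' hy'] at key
  simp only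
  rw [← key, mul_assoc, Int.units_mul_self, mul_one]

/-! ### The cyclic shift as a row operation on the determinant -/

/-- The matrix of the difference operator: `1` on the diagonal, `-1` next to it. -/
def diffCoeff (m n : ℕ) : ℤ := if n = m then 1 else if n + 1 = m then -1 else 0

/-- The action of the cyclic shift on differences: the transpose of the companion matrix of
`1 + x + ⋯ + x ^ k`. -/
def cyclicCompanion (R : Type) [CommRing R] (n : ℕ) : Matrix (Fin n) (Fin n) R :=
  Matrix.of fun j j' => if j.val + 1 = n then -1 else if j'.val = j.val + 1 then 1 else 0

theorem det_cyclicCompanion (R : Type) [CommRing R] {k : ℕ} (hk : 1 ≤ k) :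
    (cyclicCompanion R k).det = (-1) ^ k := by
  obtain ⟨n, rfl⟩ := Nat.exists_eq_succ_of_ne_zero (by omega : k ≠ 0)
  -- The first column has the single nonzero entry `-1`, in the last row, and the complementary
  -- minor is the identity.
  rw [Matrix.det_succ_column_zero, Finset.sum_eq_single (Fin.last n)]
  · have : (cyclicCompanion R n.succ).submatrix (Fin.last n).succAbove Fin.succ = 1 := by
      ext i j
      have := i.2
      simp only [cyclicCompanion, Matrix.submatrix_apply, Matrix.of_apply, Fin.succAbove_last,
        Fin.val_castSucc, Fin.val_succ, Matrix.one_apply, Fin.ext_iff]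
      rw [if_neg (by omega)]
      exact if_congr (by omega) rfl rfl
    rw [this]
    simp [cyclicCompanion, pow_succ]
  · intro i _ hi
    have h : i.val ≠ n := fun h => hi (Fin.ext h)
    simp [cyclicCompanion, h]
  · simp

/-- All rows but the last move coordinates down by one. The last row is minus the coordinate sum,
which vanishes on `e_m - e_{m-1}` and equals `1`, `-1` on the end vectors `e_0`, `-e_{k-1}`. -/
theorem sum_cyclicCompanion_mul_diffCoeff {R : Type} [CommRing R] {k : ℕ} (j : Fin k)
    (l : Fin (k + 1)) :
    ∑ j', cyclicCompanion R k j j' * ((diffCoeff (l + 1 : Fin (k + 1)).val j'.val : ℤ) : R)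
      = ((diffCoeff l.val j.val : ℤ) : R) := by
  have hl : (l + 1 : Fin (k + 1)).val = if l.val = k then 0 else l.val + 1 := by
    rw [Fin.val_add_one]
    simp [Fin.ext_iff]
  have hj := j.2
  have hl' := l.2
  rw [hl]
  by_cases h : j.val + 1 = k
  · simp only [cyclicCompanion, Matrix.of_apply, h, if_true, neg_mul, one_mul]
    rw [Finset.sum_neg_distrib]
    have hs : ∀ m : ℕ, m ≤ k → ∑ j' : Fin k, ((diffCoeff m j'.val : ℤ) : R)
        = (if m < k then 1 else 0) - if 0 < m then 1 else 0 := by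
      intro m hm
      have h0 : ∀ j' : Fin k, ((diffCoeff m j'.val : ℤ) : R)
          = (if j'.val = m then 1 else 0) - if j'.val + 1 = m then 1 else 0 := by
        intro j'
        unfold diffCoeff
        by_cases h3 : j'.val = m
        · simp [h3]
        · by_cases h4 : j'.val + 1 = m <;> simp [h3, h4]
      simp_rw [h0]
      rw [Finset.sum_sub_distrib]
      congr 1
      · split_ifs with h5
        · rw [Finset.sum_eq_single ⟨m, h5⟩] <;> simp +contextual [Fin.ext_iff]
        · exact Finset.sum_eq_zero fun j' _ => if_neg (by omega)
      · split_ifs with h5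
        · rw [Finset.sum_eq_single ⟨m - 1, by omega⟩]
          · simp; omega
          · intro b _ hb
            rw [if_neg]
            intro h6
            exact hb (Fin.ext (by simp; omega))
          · simp
        · exact Finset.sum_eq_zero fun j' _ => if_neg (by omega)
    rw [hs _ (by split_ifs <;> omega)]
    unfold diffCoeff
    by_cases h1 : l.val = k
    · simp only [h1, if_true, h]
      rw [if_neg (by omega : ¬ j.val = k), if_pos (by omega : 0 < k)]
      simp
    · by_cases h2 : j.val = l.val
      · simp only [h1, if_false, h2, if_true]
        rw [if_neg (by omega)]
        simp
      · simp only [h1, if_false, h2]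
        rw [if_pos (by omega), if_pos (by omega), if_neg (by omega)]
        simp
  · rw [Finset.sum_eq_single ⟨j.val + 1, by omega⟩]
    · simp only [cyclicCompanion, Matrix.of_apply, h, if_false, if_true, one_mul]
      congr 1
      have key : ∀ m, (m = 0 ∧ l.val = k ∨ m = l.val + 1 ∧ l.val < k) →
          diffCoeff m (j.val + 1) = diffCoeff l.val j.val := by
        intro m hm
        unfold diffCoeff
        split_ifs <;> omega
      refine key _ ?_
      split_ifs <;> omega
    · intro j' _ hj'
      have : j'.val ≠ j.val + 1 := fun h => hj' (Fin.ext h)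
      simp [cyclicCompanion, h, this]
    · simp

/-- The matrix of the differences `a_right - a_left` of weights along the edges. -/
def aztecMatrix {k : ℕ} {R : Type} [CommRing R] (a : AztecFace k → R) :
    Matrix (AztecWhite k) (AztecBlack k) R :=
  Matrix.of fun w b => ((diffCoeff w.1.val b.1.val * diffCoeff b.2.val w.2.val : ℤ) : R) *
    (a (Sum.inl (w.1, b.2)) - a (Sum.inr (b.1, w.2)))

theorem aztecMatrix_eq_ite {k : ℕ} {R : Type} [CommRing R] (a : AztecFace k → R)
    (w : AztecWhite k) (b : AztecBlack k) :
    aztecMatrix a w b = if (w, b) ∈ (aztec k).edges then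
      a ((aztec k).rightFace w b) - a ((aztec k).leftFace w b) else 0 := by
  simp only [aztec_rightFace, aztec_leftFace, mem_aztec_edges, aztecMatrix, Matrix.of_apply,
    diffCoeff]
  by_cases h1 : b.1.val = w.1.val <;> by_cases h2 : b.1.val + 1 = w.1.val <;>
  by_cases h3 : b.2.val = w.2.val + 1 <;> by_cases h4 : b.2.val = w.2.val <;>
    first
    | omega
    | simp [h1, h2, h3, h4, Ne.symm h3, Ne.symm h4]
    | (simp [h1, h2, h3]; done)
    | simp [h1, h2, h4]

/-- The determinant of the matrix of weight differences. -/
def aztecDet {k : ℕ} {R : Type} [CommRing R] (a : AztecFace k → R) : R :=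
  ((aztecMatrix a).submatrix id (aztecIndex k)).det

open scoped Kronecker in
theorem aztecMatrix_verticalShift {k : ℕ} {R : Type} [CommRing R] {a : AztecFace k → R}
    (ha : OddColumnsConstant a) :
    aztecMatrix (verticalShift a)
      = (((1 : Matrix (Fin (k + 1)) (Fin (k + 1)) R) ⊗ₖ cyclicCompanion R k) *
        aztecMatrix a).submatrix id fun b => (b.1, b.2 + 1) := by
  ext ⟨x, y⟩ ⟨x', y'⟩
  rw [Matrix.submatrix_apply, Matrix.mul_apply, Fintype.sum_prod_type, Finset.sum_eq_single x]
  · simp only [Matrix.kroneckerMap_apply, Matrix.one_apply_eq, one_mul, aztecMatrix,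
      Matrix.of_apply, id, verticalShift]
    rw [Int.cast_mul, ← sum_cyclicCompanion_mul_diffCoeff y y', Finset.mul_sum, Finset.sum_mul]
    refine Finset.sum_congr rfl fun j _ => ?_
    -- Constancy of the odd columns enters here: the weight difference does not depend on the
    -- summation index, so the row operation acts on `diffCoeff` alone.
    rw [ha x' j y]
    push_cast
    ring
  · intro x'' _ h
    simp [Matrix.one_apply_ne h.symm]
  · simp

theorem aztecDet_verticalShift {k : ℕ} (hk : 1 ≤ k) {R : Type} [CommRing R]
    {a : AztecFace k → R} (ha : OddColumnsConstant a) :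
    aztecDet (verticalShift a) = (-1) ^ k * aztecDet a := by
  let ρ : Equiv.Perm (AztecBlack k) := Equiv.prodCongrRight fun _ => finRotate (k + 1)
  have hρ : ∀ b : AztecBlack k, ρ b = (b.1, b.2 + 1) := fun b => by
    obtain ⟨x, y⟩ := b
    simp [ρ, Equiv.prodCongrRight]
  -- There are `k` black columns, each rotated by a `(k + 1)`-cycle of sign `(-1)^k`.
  have hsign : Equiv.Perm.sign (((aztecIndex k).trans ρ).trans (aztecIndex k).symm)
      = ((-1) ^ k) ^ k := by
    have := Equiv.Perm.sign_symm_trans_trans ρ (aztecIndex k).symm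
    rw [Equiv.symm_symm] at this
    rw [this, Equiv.Perm.sign_prodCongrRight]
    simp [sign_finRotate]
  have hsub : (aztecMatrix (verticalShift a)).submatrix id (aztecIndex k)
      = ((Matrix.kroneckerMap (· * ·) (1 : Matrix (Fin (k + 1)) (Fin (k + 1)) R)
          (cyclicCompanion R k) * (aztecMatrix a).submatrix id (aztecIndex k))).submatrix id
          (((aztecIndex k).trans ρ).trans (aztecIndex k).symm) := by
    rw [aztecMatrix_verticalShift ha]
    ext w w'
    simp [Matrix.mul_apply, hρ]
  rw [aztecDet, aztecDet, hsub, Matrix.det_permute', Matrix.det_mul, Matrix.det_kronecker, hsign,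
    det_cyclicCompanion R hk, Matrix.det_one, one_pow, one_mul, Fintype.card_fin, ← mul_assoc]
  congr 1
  push_cast
  rw [← pow_add, ← pow_mul, show k * (k + (k + 1)) = k + 2 * (k * k) by ring, pow_add, pow_mul]
  simp

/-! ### Degree of the determinant, and Kasteleyn's theorem -/

/-- The determinant of the weight differences has degree at most one in each weight. -/
theorem degreeOf_aztecDet_X_le {k : ℕ} (f : AztecFace k) :
    (aztecDet (R := MvPolynomial (AztecFace k) ℂ) MvPolynomial.X).degreeOf f ≤ 1 := by
  classical
  -- The coefficient matrix of each weight has rank one, namely `u · f` times `v f ·`. Expanding the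
  -- determinant by rows, a term using the same face twice has two equal rows and vanishes.
  let u : AztecWhite k → AztecFace k → ℤ := fun w f => match f with
    | Sum.inl (i, j) => if w.1 = i then diffCoeff j w.2 else 0
    | Sum.inr (i, j) => if w.2 = j then -diffCoeff w.1 i else 0
  let v : AztecFace k → AztecBlack k → ℤ := fun f b => match f with
    | Sum.inl (i, j) => if b.2 = j then diffCoeff i b.1 else 0
    | Sum.inr (i, j) => if b.1 = i then diffCoeff b.2 j else 0
  have hrow : (aztecMatrix (R := MvPolynomial (AztecFace k) ℂ) MvPolynomial.X).submatrix id
      (aztecIndex k) = fun w => ∑ f, (MvPolynomial.C ((u w f : ℤ) : ℂ) * MvPolynomial.X f) •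
        fun w' => MvPolynomial.C ((v f (aztecIndex k w') : ℤ) : ℂ) := by
    funext w w'
    simp only [Matrix.submatrix_apply, id, Finset.sum_apply, Pi.smul_apply, smul_eq_mul]
    generalize aztecIndex k w' = b
    rw [Fintype.sum_sum_type, Finset.sum_eq_single (w.1, b.2), Finset.sum_eq_single (b.1, w.2)]
    · simp [u, v, aztecMatrix]
      ring
    · rintro ⟨i, j⟩ _ h
      simp only [u, v]
      by_cases h1 : w.2 = j
      · have h2 : b.1 ≠ i := fun h2 => h (by rw [h1, h2])
        simp [h2]
      · simp [h1]
    · simp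
    · rintro ⟨i, j⟩ _ h
      simp only [u, v]
      by_cases h1 : w.1 = i
      · have h2 : b.2 ≠ j := fun h2 => h (by rw [h1, h2])
        simp [h2]
      · simp [h1]
    · simp
  have hdet : aztecDet (R := MvPolynomial (AztecFace k) ℂ) MvPolynomial.X
      = ∑ p : AztecWhite k → AztecFace k,
        (∏ w, MvPolynomial.C ((u w (p w) : ℤ) : ℂ) * MvPolynomial.X (p w)) *
          MvPolynomial.C (Matrix.det (Matrix.of fun w w' => ((v (p w) (aztecIndex k w') : ℤ) : ℂ))) := by
    rw [aztecDet, hrow]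
    refine (MultilinearMap.map_sum (Matrix.detRowAlternating (R := MvPolynomial (AztecFace k) ℂ)
      (n := AztecWhite k)).toMultilinearMap _).trans ?_
    refine Finset.sum_congr rfl fun p _ => ?_
    rw [MultilinearMap.map_smul_univ, smul_eq_mul]
    congr 1
    exact (RingHom.map_det (MvPolynomial.C : ℂ →+* MvPolynomial (AztecFace k) ℂ) _).symm
  rw [hdet]
  refine (MvPolynomial.degreeOf_sum_le _ _ _).trans (Finset.sup_le fun p _ => ?_)
  by_cases hp : Function.Injective p
  · refine (MvPolynomial.degreeOf_mul_le _ _ _).trans ?_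
    rw [MvPolynomial.degreeOf_C, add_zero]
    refine (MvPolynomial.degreeOf_prod_le _ _ _).trans ?_
    refine (Finset.sum_le_sum (g := fun w => if f = p w then 1 else 0) fun w _ => ?_).trans ?_
    · refine (MvPolynomial.degreeOf_mul_le _ _ _).trans ?_
      rw [MvPolynomial.degreeOf_C, zero_add, MvPolynomial.degreeOf_X]
    · rw [← Finset.card_filter, Finset.card_le_one]
      intro w hw w' hw'
      simp only [Finset.mem_filter, Finset.mem_univ, true_and] at hw hw'
      exact hp (hw.symm.trans hw')
  · rw [Function.Injective] at hp
    push Not at hp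
    obtain ⟨w, w', h, hne⟩ := hp
    have h0 : (Matrix.det (Matrix.of fun w w' => ((v (p w) (aztecIndex k w') : ℤ) : ℂ))) = 0 :=
      Matrix.det_zero_of_row_eq hne (by ext w''; simp only [Matrix.of_apply, h])
    rw [h0]
    simp

/-- Kasteleyn's theorem for the Aztec diamond: the partition function of oriented dimers is, up to
a sign that does not depend on the weights, the determinant of the matrix of weight differences. -/
theorem exists_partitionFunction_eq_aztecDet {k : ℕ} (hk : 1 ≤ k)
    {φ : DirEdge (AztecWhite k) (AztecBlack k) → ℤˣ} (hφ : (aztec k).IsKasteleyn φ) :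
    ∃ c : ℤˣ, ∀ (R : Type) [CommRing R] (a : AztecFace k → R),
      (aztec k).partitionFunction φ a = ((c : ℤ) : R) * aztecDet a := by
  obtain ⟨g, h, hgauge⟩ := exists_gauge hk hφ
  obtain ⟨κ, hκ⟩ := exists_prod_northEastSign k
  -- A perfect matching meets every vertex once, so the gauge contributes the same factor to all of
  -- them. The sign is chosen before the ring, so it serves both complex and formal weights.
  refine ⟨(∏ w, g w) * (∏ b, h b) * κ, fun R _ a => ?_⟩
  rw [(aztec k).partitionFunction_eq_sum_equiv hφ.skew, aztecDet, ← Matrix.det_transpose,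
    Matrix.det_apply', Finset.mul_sum]
  refine Fintype.sum_equiv ((Equiv.refl _).equivCongr (aztecIndex k).symm) _ _ fun σ => ?_
  have hσ' : (Equiv.refl _).equivCongr (aztecIndex k).symm σ = σ.trans (aztecIndex k).symm := by
    ext w : 1
    simp
  rw [hσ']
  have hM : ∀ w, ((aztecMatrix a).submatrix id (aztecIndex k)).transpose
      ((σ.trans (aztecIndex k).symm) w) w = aztecMatrix a w (σ w) := fun w => by
    simp [Matrix.transpose_apply]
  simp_rw [hM]
  by_cases hσ : ∀ w, (w, σ w) ∈ (aztec k).edges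
  · have h1 : ∏ w, φ (w, σ w, true)
        = (∏ w, g w) * (∏ b, h b) * κ * Equiv.Perm.sign (σ.trans (aztecIndex k).symm) := by
      rw [mul_assoc _ κ, ← hκ σ hσ, ← Equiv.prod_comp σ h, ← Finset.prod_mul_distrib,
        ← Finset.prod_mul_distrib]
      exact Finset.prod_congr rfl fun w _ => hgauge w _ (hσ w)
    rw [← mul_assoc, ← Int.cast_mul, ← Units.val_mul, ← h1, Units.coe_prod, Int.cast_prod,
      ← Finset.prod_mul_distrib]
    refine Finset.prod_congr rfl fun w _ => ?_
    rw [if_pos (hσ w), aztecMatrix_eq_ite, if_pos (hσ w)]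
  · push Not at hσ
    obtain ⟨w, hw⟩ := hσ
    rw [Finset.prod_eq_zero (Finset.mem_univ w) (if_neg hw),
      Finset.prod_eq_zero (f := fun w => aztecMatrix a w (σ w)) (Finset.mem_univ w)
        (by rw [aztecMatrix_eq_ite, if_neg hw]), mul_zero, mul_zero]

/-! ### Transfer to the partition function and the ratio functions -/

/-- The cyclic shift of the faces in the even columns. -/
def aztecFaceShift (k : ℕ) : Equiv.Perm (AztecFace k) :=
  Equiv.sumCongr ((Equiv.refl _).prodCongr (Equiv.addRight 1)) (Equiv.refl _)

theorem verticalShift_eq {k : ℕ} {α : Type} (a : AztecFace k → α) :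
    verticalShift a = fun f => a (aztecFaceShift k f) := by
  funext f
  rcases f with ⟨i, j⟩ | ⟨i, j⟩ <;> rfl

theorem OddColumnsConstant.comp {k : ℕ} {α β : Type} {a : AztecFace k → α}
    (ha : OddColumnsConstant a) (g : α → β) : OddColumnsConstant fun f => g (a f) :=
  fun i j j' => congrArg g (ha i j j')

theorem OddColumnsConstant.comp₂ {k : ℕ} {α β γ : Type} {a : AztecFace k → α}
    {b : AztecFace k → β} (ha : OddColumnsConstant a) (hb : OddColumnsConstant b)
    (g : α → β → γ) : OddColumnsConstant fun f => g (a f) (b f) :=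
  fun i j j' => congrArg₂ g (ha i j j') (hb i j j')

/-- The vertical shift multiplies the partition function by a sign which does not depend on the
weights, also when the Kasteleyn orientation is changed. -/
theorem exists_partitionFunction_verticalShift {k : ℕ} (hk : 1 ≤ k)
    {φ φ' : DirEdge (AztecWhite k) (AztecBlack k) → ℤˣ} (hφ : (aztec k).IsKasteleyn φ)
    (hφ' : (aztec k).IsKasteleyn φ') :
    ∃ s : ℂ, s ≠ 0 ∧ ∀ a : AztecFace k → ℂ, OddColumnsConstant a →
      (aztec k).partitionFunction φ' (verticalShift a)
        = s * (aztec k).partitionFunction φ a := by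
  obtain ⟨c, hc⟩ := exists_partitionFunction_eq_aztecDet hk hφ
  obtain ⟨c', hc'⟩ := exists_partitionFunction_eq_aztecDet hk hφ'
  have hcc : ((c : ℤ) : ℂ) * ((c : ℤ) : ℂ) = 1 := by
    rw [← Int.cast_mul, ← Units.val_mul, Int.units_mul_self]
    simp
  refine ⟨((c' : ℤ) : ℂ) * (-1) ^ k * ((c : ℤ) : ℂ), by simp, fun a ha => ?_⟩
  rw [hc, hc', aztecDet_verticalShift hk ha]
  linear_combination (-((c' : ℤ) : ℂ) * (-1) ^ k * aztecDet a) * hcc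

theorem partitionFunction_verticalShift {k : ℕ} (hk : 1 ≤ k)
    {φ : DirEdge (AztecWhite k) (AztecBlack k) → ℤˣ} (hφ : (aztec k).IsKasteleyn φ)
    {a : AztecFace k → ℂ} (ha : OddColumnsConstant a) :
    (aztec k).partitionFunction φ a
      = (-1) ^ k * (aztec k).partitionFunction φ (verticalShift a) := by
  obtain ⟨c, hc⟩ := exists_partitionFunction_eq_aztecDet hk hφ
  rw [hc, hc, aztecDet_verticalShift hk ha]
  have : ((-1 : ℂ) ^ k) * (-1) ^ k = 1 := by rw [← mul_pow]; simp
  linear_combination (-((c : ℤ) : ℂ) * aztecDet a) * this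

/-- The partition function has degree at most one in each weight. -/
theorem le_one_of_mem_support_partitionFunction {k : ℕ} (hk : 1 ≤ k)
    {φ : DirEdge (AztecWhite k) (AztecBlack k) → ℤˣ} (hφ : (aztec k).IsKasteleyn φ)
    {m : AztecFace k →₀ ℕ} (hm : m ∈ ((aztec k).partitionFunction φ
      (MvPolynomial.X (R := ℂ))).support) (f : AztecFace k) : m f ≤ 1 := by
  obtain ⟨c, hc⟩ := exists_partitionFunction_eq_aztecDet hk hφ
  refine (MvPolynomial.monomial_le_degreeOf f hm).trans ?_
  rw [hc, ← map_intCast (MvPolynomial.C (R := ℂ) (σ := AztecFace k))]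
  exact (MvPolynomial.degreeOf_C_mul_le _ _ _).trans (degreeOf_aztecDet_X_le f)

theorem continuous_homEval {F : Type} [Fintype F] (n : F → ℕ) (P : MvPolynomial F ℂ)
    {x y : ℂ → F → ℂ} (hx : Continuous x) (hy : Continuous y) :
    Continuous fun t => homEval n P (x t) (y t) := by
  unfold homEval
  fun_prop

theorem quotHat_mul_left {s : ℂ} (hs : s ≠ 0) (p q : ℂ) :
    quotHat (s * p) (s * q) = quotHat p q := by
  unfold quotHat
  simp only [mul_eq_zero, hs, false_or, mul_div_mul_left p q hs]

section Homogeneous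

variable {k : ℕ} (hk : 1 ≤ k) {φ φ' : DirEdge (AztecWhite k) (AztecBlack k) → ℤˣ}
  (hφ : (aztec k).IsKasteleyn φ) (hφ' : (aztec k).IsKasteleyn φ')

include hk hφ

theorem homEval_partitionFunction (x : AztecFace k → ℂ) {y : AztecFace k → ℂ}
    (hy : ∀ f, y f ≠ 0) :
    homEval (aztec k).faceExponent ((aztec k).partitionFunction φ MvPolynomial.X) x y
      = (∏ f, y f) * (aztec k).partitionFunction φ fun f => x f / y f := by
  rw [homEval_eq _ _ _ _ (fun m hm f => ?_) hy, FaceGraph.eval_partitionFunction]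
  · simp only [aztec_faceExponent hk, pow_one]
  · rw [aztec_faceExponent hk]
    exact le_one_of_mem_support_partitionFunction hk hφ hm f

include hφ'

theorem homEval_verticalShift {s : ℂ} (hs : ∀ a : AztecFace k → ℂ, OddColumnsConstant a →
      (aztec k).partitionFunction φ' (verticalShift a)
        = s * (aztec k).partitionFunction φ a) {x y : AztecFace k → ℂ}
    (hx : OddColumnsConstant x) (hy : OddColumnsConstant y) :
    homEval (aztec k).faceExponent ((aztec k).partitionFunction φ' MvPolynomial.X)
        (verticalShift x) (verticalShift y)
      = s * homEval (aztec k).faceExponent ((aztec k).partitionFunction φ MvPolynomial.X) x y := by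
  -- Adding one common `t` to all denominators keeps the odd columns constant and, for all but
  -- finitely many `t`, makes every denominator nonzero. The identity at `t = 0` follows by
  -- continuity.
  have hdense : Dense (Set.range fun f => -y f)ᶜ := (Set.finite_range _).countable.dense_compl ℂ
  have key := Continuous.ext_on hdense
    (f := fun t : ℂ => homEval (aztec k).faceExponent
      ((aztec k).partitionFunction φ' MvPolynomial.X) (verticalShift x)
        (verticalShift fun f => y f + t))
    (g := fun t : ℂ => s * homEval (aztec k).faceExponent
      ((aztec k).partitionFunction φ MvPolynomial.X) x fun f => y f + t)
    (continuous_homEval _ _ continuous_const (by simp only [verticalShift_eq]; fun_prop))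
    (continuous_const.mul (continuous_homEval _ _ continuous_const (by fun_prop))) ?_
  · simpa using congrFun key 0
  · intro t ht
    have ht' : ∀ f, y f + t ≠ 0 := fun f h => ht ⟨f, by linear_combination -h⟩
    have h1 := hs (fun f => x f / (y f + t)) (hx.comp₂ hy fun u v => u / (v + t))
    simp only [verticalShift_eq] at h1 ⊢
    rw [homEval_partitionFunction hk hφ' _ fun f => ht' _, homEval_partitionFunction hk hφ _ ht', h1,
      Equiv.prod_comp (aztecFaceShift k) fun f => y f + t]
    ring

theorem ratioHat_verticalShift {a : AztecFace k → OnePoint ℂ} (ha : OddColumnsConstant a) :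
    (aztec k).ratioHat φ a = (aztec k).ratioHat φ' (verticalShift a) := by
  obtain ⟨s, hs0, hs⟩ := exists_partitionFunction_verticalShift hk hφ hφ'
  have h1 := homEval_verticalShift hk hφ hφ' hs (ha.comp homNum) (ha.comp homDen)
  have h2 := homEval_verticalShift hk hφ hφ' hs (ha.comp homDen) (ha.comp homNum)
  simp only [verticalShift_eq] at h1 h2
  simp only [FaceGraph.ratioHat, verticalShift_eq]
  -- Exchanging the homogeneous coordinates exchanges numerator and denominator up to the constant,
  -- so both acquire the same nonzero factor `s`, which cancels even for the values `∞` and `0 / 0`.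
  rw [h1, h2, mul_left_comm, quotHat_mul_left hs0]

theorem ratio_verticalShift {a : AztecFace k → ℂ} (ha : OddColumnsConstant a) :
    (aztec k).ratio φ a = (aztec k).ratio φ' (verticalShift a) := by
  obtain ⟨s, hs0, hs⟩ := exists_partitionFunction_verticalShift hk hφ hφ'
  have h1 := hs a ha
  have h2 := hs _ (ha.comp fun z => z⁻¹)
  have h3 : (aztec k).prefactor (verticalShift a) = (aztec k).prefactor a := by
    simp only [FaceGraph.prefactor, aztec_faceExponent hk, pow_one, verticalShift_eq]
    rw [Equiv.prod_comp (aztecFaceShift k) a]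
  simp only [verticalShift_eq] at h1 h2 h3
  simp only [FaceGraph.ratio, verticalShift_eq]
  rw [h1, h2, h3, mul_left_comm, quotHat_mul_left hs0]

end Homogeneous

theorem theorem5p4 (k : ℕ) (hk : 1 ≤ k) :
    -- the partition functions, for every Kasteleyn orientation
    (∀ φ : DirEdge (AztecWhite k) (AztecBlack k) → ℤˣ, (aztec k).IsKasteleyn φ →
      ∀ a : AztecFace k → ℂ, OddColumnsConstant a →
        (aztec k).partitionFunction φ a
          = (-1) ^ k * (aztec k).partitionFunction φ (verticalShift a)) ∧
    -- the ratio functions, whatever Kasteleyn orientations they are computed with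
    (∀ φ φ' : DirEdge (AztecWhite k) (AztecBlack k) → ℤˣ,
      (aztec k).IsKasteleyn φ → (aztec k).IsKasteleyn φ' →
        (∀ a : AztecFace k → ℂ, OddColumnsConstant a → (∀ f, a f ≠ 0) →
          (aztec k).ratio φ a = (aztec k).ratio φ' (verticalShift a)) ∧
        (∀ a : AztecFace k → OnePoint ℂ, OddColumnsConstant a →
          (aztec k).ratioHat φ a = (aztec k).ratioHat φ' (verticalShift a))) := by
  exact ⟨fun φ hφ a ha => partitionFunction_verticalShift hk hφ ha, fun φ φ' hφ hφ' =>
    ⟨fun a ha _ => ratio_verticalShift hk hφ hφ' ha,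
      fun a ha => ratioHat_verticalShift hk hφ hφ' ha⟩⟩
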